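/- Let $q$ be a prime. A $\mathbb{Z}_q$-order in $M_2(\mathbb{Q}_q)$ is a $\mathbb{Z}_q$-subalgebra (with the same $1$) that is finitely generated as a $\mathbb{Z}_q$-module and spans $M_2(\mathbb{Q}_q)$ over $\mathbb{Q}_q$; a maximal order is an order that is maximal with respect to inclusion. Regard the maximal orders of $M_2(\mathbb{Q}_q)$ as the vertices of the Bruhat-Tits tree, where $\Lambda$ and $\Lambda'$ are joined by an edge if and only if $[\Lambda:\Lambda\cap\Lambda']=[\Lambda':\Lambda\cap\Lambda']=q$, and let $d$ be the distance in this graph. For a maximal order $\Lambda$ and an integer $r\ge 0$ put $N_r(\Lambda)=\{\Lambda' : d(\Lambda',\Lambda)\le r\}$. Proposition. Fix an integer $r\ge 0$ and a maximal order $\Lambda$ in $M_2(\mathbb{Q}_q)$, and let $\tilde\Lambda=\bigcap_{\Lambda'\in N_r(\Lambda)}\Lambda'$. Then $\tilde\Lambda=\mathbb{Z}_q+q^r\Lambda$, and the set of maximal orders containing $\tilde\Lambda$ is equal to $N_r(\Lambda)$. -/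

import Mathlib

/-- A `ℤ_q`-order in `M_2(ℚ_q)`: a `ℤ_q`-subalgebra (so it contains `1`) that is a `ℤ_q`-lattice,
i.e. is finitely generated over `ℤ_q` and spans `M_2(ℚ_q)` over `ℚ_q`. -/
def IsLocalOrder (q : ℕ) [Fact q.Prime]
    (O : Subalgebra ℤ_[q] (Matrix (Fin 2) (Fin 2) ℚ_[q])) : Prop :=
  Submodule.IsLattice ℚ_[q] (Subalgebra.toSubmodule O)

/-- The maximal orders of `M_2(ℚ_q)`: the maximal elements, for inclusion, among all orders. -/
def MaximalOrder (q : ℕ) [Fact q.Prime] : Type :=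
  {O : Subalgebra ℤ_[q] (Matrix (Fin 2) (Fin 2) ℚ_[q]) // Maximal (IsLocalOrder q) O}

namespace MaximalOrder

/-- The index `[O : O ∩ O']` of additive groups (with value `0` if it is infinite). -/
noncomputable def interIndex {q : ℕ} [Fact q.Prime]
    (O O' : Subalgebra ℤ_[q] (Matrix (Fin 2) (Fin 2) ℚ_[q])) : ℕ :=
  (Subalgebra.toSubmodule (O ⊓ O')).toAddSubgroup.relIndex
    (Subalgebra.toSubmodule O).toAddSubgroup

/-- The Bruhat-Tits tree for `GL_2(ℚ_q)`, with the maximal orders of `M_2(ℚ_q)` as vertices: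
`O` and `O'` are neighbors iff `[O : O ∩ O'] = [O' : O ∩ O'] = q`. -/
def bruhatTitsTree (q : ℕ) [Fact q.Prime] : SimpleGraph (MaximalOrder q) where
  Adj O O' := interIndex O.1 O'.1 = q ∧ interIndex O'.1 O.1 = q
  symm := ⟨fun _ _ h => ⟨h.2, h.1⟩⟩
  loopless := ⟨fun O h => by
    have h1 : interIndex O.1 O.1 = 1 := by
      simp [interIndex]
    exact (Fact.out : q.Prime).ne_one (h.1.symm.trans h1)⟩

/-- The `r`-neighborhood `N_r(O)`: the maximal orders at distance at most `r` from `O`. The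
distance is the extended one, so vertices not joined by a path would be at distance `⊤`. -/
def neighborhood {q : ℕ} [Fact q.Prime] (r : ℕ) (O : MaximalOrder q) : Set (MaximalOrder q) :=
  {O' | (bruhatTitsTree q).edist O' O ≤ r}

/-- The intersection of all the maximal orders in the `r`-neighborhood of `O`. -/
noncomputable def neighborhoodInter {q : ℕ} [Fact q.Prime] (r : ℕ) (O : MaximalOrder q) :
    Subalgebra ℤ_[q] (Matrix (Fin 2) (Fin 2) ℚ_[q]) :=
  ⨅ O' ∈ neighborhood r O, O'.1

end MaximalOrder

open Matrix

namespace MaximalOrder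

variable {q : ℕ} [Fact q.Prime]

/-! Every maximal order is a conjugate of `M_2(ℤ_q)`, and by the Cartan decomposition any two are
simultaneously conjugate to `M_2(ℤ_q)` and its conjugate by `diag(1, q^n)` (`exists_simultaneous`).
The crux is `mem_neighborhood_iff`: Λ' lies in N_r(Λ) iff q^r Λ ⊆ Λ'. Crossing an edge costs a
factor q, because the index is q; conversely the inclusion forces n ≤ r, and the powers of `diag(1,
q)` give a path of length n. Bounds suffice: neither acyclicity nor an exact distance formula is
needed. Hence q^r Λ lies in the intersection, which gives one inclusion and the claim on maximal
orders. For the other inclusion, three members of N_r(Λ) already force the off-diagonal entries and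
the difference of the diagonal entries to be divisible by q^r
(`exists_eq_add_of_mem_neighborhoodInter`). -/

/-! ### Conjugates of `M_2(ℤ_q)` and stable lattices. -/

/-- The standard maximal order `M_2(ℤ_q)`. -/
noncomputable def integralMatrices (q : ℕ) [Fact q.Prime] :
    Subalgebra ℤ_[q] (Matrix (Fin 2) (Fin 2) ℚ_[q]) :=
  (Algebra.ofId ℤ_[q] ℚ_[q]).mapMatrix.range

theorem mem_integralMatrices {x : Matrix (Fin 2) (Fin 2) ℚ_[q]} :
    x ∈ integralMatrices q ↔ ∀ i j, ‖x i j‖ ≤ 1 := by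
  constructor
  · rintro ⟨y, rfl⟩ i j
    exact (y i j).2
  · intro h
    exact ⟨Matrix.of fun i j => ⟨x i j, h i j⟩, by ext i j; rfl⟩

theorem mem_integralMatrices_fin_two {a b c d : ℚ_[q]} :
    !![a, b; c, d] ∈ integralMatrices q ↔ ‖a‖ ≤ 1 ∧ ‖b‖ ≤ 1 ∧ ‖c‖ ≤ 1 ∧ ‖d‖ ≤ 1 := by
  simp [mem_integralMatrices, Fin.forall_fin_two, and_assoc]

/-- The order `g M_2(ℤ_q) g⁻¹`. -/
noncomputable def conjOrder (g : GL (Fin 2) ℚ_[q]) :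
    Subalgebra ℤ_[q] (Matrix (Fin 2) (Fin 2) ℚ_[q]) where
  carrier := {x | g⁻¹.val * x * g.val ∈ integralMatrices q}
  mul_mem' {x y} hx hy := by
    have h := mul_mem (show _ ∈ integralMatrices q from hx) (show _ ∈ integralMatrices q from hy)
    have e : g⁻¹.val * (x * y) * g.val =
        (g⁻¹.val * x * g.val) * (g⁻¹.val * y * g.val) := by
      simp only [mul_assoc, Units.mul_inv_cancel_left]
    rw [Set.mem_ofPred_eq, e]
    exact h
  add_mem' {x y} hx hy := by
    have h := add_mem (show _ ∈ integralMatrices q from hx) (show _ ∈ integralMatrices q from hy)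
    rw [Set.mem_ofPred_eq, mul_add, add_mul]
    exact h
  algebraMap_mem' a := by
    rw [Set.mem_ofPred_eq, ← Algebra.commutes, mul_assoc, Units.inv_mul, mul_one]
    exact Subalgebra.algebraMap_mem _ a

theorem mem_conjOrder {g : GL (Fin 2) ℚ_[q]} {x : Matrix (Fin 2) (Fin 2) ℚ_[q]} :
    x ∈ conjOrder g ↔
      g⁻¹.val * x * g.val ∈ integralMatrices q := Iff.rfl

theorem conj_mem_conjOrder {g : GL (Fin 2) ℚ_[q]} {y : Matrix (Fin 2) (Fin 2) ℚ_[q]} :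
    g.val * y * g⁻¹.val ∈ conjOrder g ↔ y ∈ integralMatrices q := by
  rw [mem_conjOrder]
  simp only [mul_assoc, Units.inv_mul_cancel_left, Units.inv_mul, mul_one]

theorem conj_inv_conj (g : GL (Fin 2) ℚ_[q]) (x : Matrix (Fin 2) (Fin 2) ℚ_[q]) :
    g.val * (g⁻¹.val * x * g.val) * g⁻¹.val = x := by
  simp only [mul_assoc, Units.mul_inv_cancel_left, Units.mul_inv, mul_one]

theorem isLocalOrder_conjOrder (g : GL (Fin 2) ℚ_[q]) : IsLocalOrder q (conjOrder g) where
  fg := by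
    let f : Matrix (Fin 2) (Fin 2) ℤ_[q] →ₗ[ℤ_[q]] Matrix (Fin 2) (Fin 2) ℚ_[q] :=
      (LinearMap.mulRight ℤ_[q] g⁻¹.val) ∘ₗ
        (LinearMap.mulLeft ℤ_[q] g.val) ∘ₗ
        (Algebra.ofId ℤ_[q] ℚ_[q]).mapMatrix.toLinearMap
    have e : Subalgebra.toSubmodule (conjOrder g) = LinearMap.range f := by
      ext x
      rw [Subalgebra.mem_toSubmodule]
      constructor
      · rintro ⟨y, hy⟩
        refine ⟨y, ?_⟩
        rw [← conj_inv_conj g x, ← hy]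
        rfl
      · rintro ⟨y, rfl⟩
        exact conj_mem_conjOrder.2 ⟨y, rfl⟩
    rw [e, LinearMap.range_eq_map]
    exact Module.Finite.fg_top.map f
  span_eq_top := by
    rw [eq_top_iff]
    intro x _
    rw [← conj_inv_conj g x, matrix_eq_sum_single (g⁻¹.val * x * g.val)]
    simp only [Finset.mul_sum, Finset.sum_mul]
    refine Submodule.sum_mem _ fun i _ => Submodule.sum_mem _ fun j _ => ?_
    have e : single i j ((g⁻¹.val * x * g.val) i j) =
        ((g⁻¹.val * x * g.val) i j) • single i j 1 := by
      rw [smul_single, smul_eq_mul, mul_one]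
    rw [e, mul_smul_comm, smul_mul_assoc]
    refine Submodule.smul_mem _ _ (Submodule.subset_span ?_)
    refine conj_mem_conjOrder.2 (mem_integralMatrices.2 fun k l => ?_)
    rw [single_apply]
    split_ifs <;> simp

/-- Every order stabilizes a lattice, so it is contained in a conjugate of `M_2(ℤ_q)`. -/
theorem exists_le_conjOrder {O : Subalgebra ℤ_[q] (Matrix (Fin 2) (Fin 2) ℚ_[q])}
    (hO : IsLocalOrder q O) : ∃ g : GL (Fin 2) ℚ_[q], O ≤ conjOrder g := by
  let ev (i : Fin 2) : Matrix (Fin 2) (Fin 2) ℚ_[q] →ₗ[ℤ_[q]] (Fin 2 → ℚ_[q]) :=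
    { toFun := fun x k => x k i
      map_add' := fun _ _ => rfl
      map_smul' := fun _ _ => rfl }
  -- The lattice spanned by the columns of elements of `O`, that is, `O` applied to the standard
  -- basis vectors; it is stable since `O` is closed under products.
  let M : Submodule ℤ_[q] (Fin 2 → ℚ_[q]) := ⨆ i, (Subalgebra.toSubmodule O).map (ev i)
  have hmul : ∀ x ∈ O, ∀ v ∈ M, x *ᵥ v ∈ M := by
    intro x hx v hv
    have hle : M ≤ M.comap ((mulVecLin x).restrictScalars ℤ_[q]) := by
      refine iSup_le fun i => ?_
      rintro _ ⟨y, hy, rfl⟩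
      exact Submodule.mem_iSup_of_mem i ⟨x * y, O.mul_mem hx hy, rfl⟩
    exact hle hv
  have hM : Submodule.IsLattice ℚ_[q] M :=
    { fg := Submodule.fg_iSup _ fun i => hO.fg.map _
      span_eq_top := by
        rw [eq_top_iff]
        intro v _
        have e : v = ∑ i, v i • (Pi.single i 1 : Fin 2 → ℚ_[q]) := by
          simpa using (pi_eq_sum_univ' v)
        rw [e]
        refine Submodule.sum_mem _ fun i _ => Submodule.smul_mem _ _ (Submodule.subset_span ?_)
        refine Submodule.mem_iSup_of_mem i ⟨1, O.one_mem, ?_⟩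
        ext k
        simp only [Pi.single_apply]
        exact Matrix.one_apply }
  have hfr : Module.finrank ℤ_[q] M = 2 := by
    simpa using Submodule.IsLattice.finrank_of_pi ℚ_[q] M
  let b : Module.Basis (Fin 2) ℤ_[q] M := Module.finBasisOfFinrankEq ℤ_[q] M hfr
  let B := b.extendOfIsLattice ℚ_[q]
  -- The columns of `g` are a ℤ_q-basis of `M`; in this basis each `x` in `O` acts by an integral
  -- matrix, `N` below.
  let g : GL (Fin 2) ℚ_[q] :=
    ⟨(Pi.basisFun ℚ_[q] (Fin 2)).toMatrix B, B.toMatrix (Pi.basisFun ℚ_[q] (Fin 2)),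
      Module.Basis.toMatrix_mul_toMatrix_flip _ _, Module.Basis.toMatrix_mul_toMatrix_flip _ _⟩
  have hg : ∀ i j, g.val i j = (b j : Fin 2 → ℚ_[q]) i := by
    intro i j
    simp [g, B, Module.Basis.toMatrix_apply]
  refine ⟨g, fun x hx => ?_⟩
  let N : Matrix (Fin 2) (Fin 2) ℤ_[q] :=
    Matrix.of fun i j => b.repr ⟨x *ᵥ b j, hmul x hx _ (b j).2⟩ i
  refine ⟨N, ?_⟩
  have key : x * g.val =
      g * (Algebra.ofId ℤ_[q] ℚ_[q]).mapMatrix N := by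
    ext i j
    have h := b.sum_repr ⟨x *ᵥ b j, hmul x hx _ (b j).2⟩
    have h2 := congrFun (congrArg Subtype.val h) i
    simp only [Fin.sum_univ_two, Submodule.coe_add, Submodule.coe_smul, Pi.add_apply,
      Pi.smul_apply] at h2
    simp only [mulVec, dotProduct, Fin.sum_univ_two] at h2
    simp only [mul_apply, Fin.sum_univ_two, hg, ← h2]
    simp only [N, AlgHom.mapMatrix_apply, Matrix.map_apply, Matrix.of_apply, Algebra.ofId_apply,
      Algebra.smul_def]
    ring_nf
  rw [mul_assoc, key, Units.inv_mul_cancel_left]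
  rfl

/-! ### Cartan decomposition and relative position. -/

theorem conjOrder_mul_congr (g : GL (Fin 2) ℚ_[q]) {h k : GL (Fin 2) ℚ_[q]}
    (e : conjOrder h = conjOrder k) : conjOrder (g * h) = conjOrder (g * k) := by
  ext x
  have := SetLike.ext_iff.1 e (g⁻¹.val * x * g.val)
  simpa only [mem_conjOrder, _root_.mul_inv_rev, Units.val_mul, mul_assoc] using this

theorem conjOrder_mul_of_integral (g : GL (Fin 2) ℚ_[q]) {k : GL (Fin 2) ℚ_[q]}
    (hk : k.val ∈ integralMatrices q)
    (hk' : k⁻¹.val ∈ integralMatrices q) :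
    conjOrder (g * k) = conjOrder g := by
  conv_rhs => rw [← mul_one g]
  refine conjOrder_mul_congr g ?_
  ext x
  simp only [mem_conjOrder, inv_one, Units.val_one, one_mul, mul_one]
  refine ⟨fun h => ?_, fun h => mul_mem (mul_mem hk' h) hk⟩
  rw [← conj_inv_conj k x]
  exact mul_mem (mul_mem hk h) hk'

/-- Scalars are central, so they cancel in the conjugation. -/
theorem conjOrder_eq_of_smul {g h : GL (Fin 2) ℚ_[q]} {z : ℚ_[q]}
    (e : h.val = z • g.val) :
    conjOrder h = conjOrder g := by
  have hinv : z • h⁻¹.val = g⁻¹.val := by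
    have : g.val * (z • h⁻¹.val) = 1 := by
      rw [mul_smul_comm, ← smul_mul_assoc, ← e, Units.mul_inv]
    rw [← Units.inv_mul_cancel_left g (z • h⁻¹.val), this, mul_one]
  ext x
  rw [mem_conjOrder, mem_conjOrder, ← hinv, e]
  simp only [mul_smul_comm, smul_mul_assoc]

theorem natCast_prime_ne_zero (q : ℕ) [Fact q.Prime] : (q : ℚ_[q]) ≠ 0 :=
  Nat.cast_ne_zero.2 (Fact.out : q.Prime).ne_zero

/-- The image of `GL_2(ℤ_q)` in `GL_2(ℚ_q)`. -/
noncomputable def integralUnits (q : ℕ) [Fact q.Prime] : Subgroup (GL (Fin 2) ℚ_[q]) where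
  carrier := {k | k.val ∈ integralMatrices q ∧ k⁻¹.val ∈ integralMatrices q}
  mul_mem' {a b} ha hb := by
    refine ⟨mul_mem ha.1 hb.1, ?_⟩
    rw [_root_.mul_inv_rev]
    exact mul_mem hb.2 ha.2
  one_mem' := by
    refine ⟨one_mem _, ?_⟩
    rw [inv_one]
    exact one_mem _
  inv_mem' {a} ha := by
    refine ⟨ha.2, ?_⟩
    rw [inv_inv]
    exact ha.1

theorem conjOrder_mul_integralUnits (g : GL (Fin 2) ℚ_[q]) {k : GL (Fin 2) ℚ_[q]}
    (hk : k ∈ integralUnits q) : conjOrder (g * k) = conjOrder g :=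
  conjOrder_mul_of_integral g hk.1 hk.2

/-- The diagonal matrix with entries `1` and `q ^ n`. -/
noncomputable def diagPow (q : ℕ) [Fact q.Prime] (n : ℕ) : GL (Fin 2) ℚ_[q] where
  val := !![1, 0; 0, (q : ℚ_[q]) ^ n]
  inv := !![1, 0; 0, ((q : ℚ_[q]) ^ n)⁻¹]
  val_inv := by
    simp [one_fin_two, natCast_prime_ne_zero q]
  inv_val := by
    simp [one_fin_two, natCast_prime_ne_zero q]

theorem val_diagPow (n : ℕ) : (diagPow q n).val = !![1, 0; 0, (q : ℚ_[q]) ^ n] := rfl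

theorem val_inv_diagPow (n : ℕ) :
    (diagPow q n)⁻¹.val = !![1, 0; 0, ((q : ℚ_[q]) ^ n)⁻¹] := rfl

theorem diagPow_zero : diagPow q 0 = 1 := by
  ext1
  simp [val_diagPow, one_fin_two]

theorem diagPow_succ (n : ℕ) : diagPow q (n + 1) = diagPow q n * diagPow q 1 := by
  ext1
  simp [val_diagPow, pow_succ]

/-- The matrix exchanging the two coordinates. -/
noncomputable def swapUnit (q : ℕ) [Fact q.Prime] : GL (Fin 2) ℚ_[q] where
  val := !![0, 1; 1, 0]
  inv := !![0, 1; 1, 0]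
  val_inv := by simp [one_fin_two]
  inv_val := by simp [one_fin_two]

theorem val_swapUnit : (swapUnit q).val = !![0, 1; 1, 0] := rfl

theorem val_inv_swapUnit : (swapUnit q)⁻¹.val = !![0, 1; 1, 0] := rfl

theorem swapUnit_mem : swapUnit q ∈ integralUnits q := by
  constructor
  · rw [val_swapUnit, mem_integralMatrices_fin_two]; simp
  · rw [val_inv_swapUnit, mem_integralMatrices_fin_two]; simp

theorem swapUnit_mul_self : swapUnit q * swapUnit q = 1 := by
  ext1
  simp [val_swapUnit, one_fin_two]

/-- The upper triangular matrix with diagonal `1`, `u` and corner entry `b`. -/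
noncomputable def upperUnit (b : ℚ_[q]) (u : ℚ_[q]) (hu : u ≠ 0) : GL (Fin 2) ℚ_[q] where
  val := !![1, b; 0, u]
  inv := !![1, -b * u⁻¹; 0, u⁻¹]
  val_inv := by simp [one_fin_two, hu]
  inv_val := by simp [one_fin_two, hu]

theorem upperUnit_mem {b u : ℚ_[q]} (hu : u ≠ 0) (hb : ‖b‖ ≤ 1) (hu1 : ‖u‖ = 1) :
    upperUnit b u hu ∈ integralUnits q := by
  constructor
  · change !![1, b; 0, u] ∈ _
    rw [mem_integralMatrices_fin_two]
    simp [hb, hu1]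
  · change !![1, -b * u⁻¹; 0, u⁻¹] ∈ _
    rw [mem_integralMatrices_fin_two]
    simp [hb, hu1]

/-- The lower unitriangular matrix with corner entry `c`. -/
noncomputable def lowerUnit (c : ℚ_[q]) : GL (Fin 2) ℚ_[q] where
  val := !![1, 0; c, 1]
  inv := !![1, 0; -c, 1]
  val_inv := by simp [one_fin_two]
  inv_val := by simp [one_fin_two]

theorem lowerUnit_mem {c : ℚ_[q]} (hc : ‖c‖ ≤ 1) : lowerUnit c ∈ integralUnits q := by
  constructor
  · change !![1, 0; c, 1] ∈ _
    rw [mem_integralMatrices_fin_two]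
    simp [hc]
  · change !![1, 0; -c, 1] ∈ _
    rw [mem_integralMatrices_fin_two]
    simp [hc]

theorem exists_eq_unit_mul_pow {w : ℚ_[q]} (hw0 : w ≠ 0) (hw : ‖w‖ ≤ 1) :
    ∃ (u : ℚ_[q]) (n : ℕ), ‖u‖ = 1 ∧ w = u * (q : ℚ_[q]) ^ n := by
  obtain ⟨z, rfl⟩ : ∃ z : ℤ_[q], (z : ℚ_[q]) = w := ⟨⟨w, hw⟩, rfl⟩
  have h0 : z ≠ 0 := fun h => hw0 (by rw [h]; rfl)
  refine ⟨((PadicInt.unitCoeff h0 : ℤ_[q]) : ℚ_[q]), z.valuation, PadicInt.norm_units _, ?_⟩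
  simpa using congrArg (fun z : ℤ_[q] => (z : ℚ_[q])) (PadicInt.unitCoeff_spec h0)

/-- The Cartan decomposition when the top left entry has maximal norm. -/
theorem exists_conjOrder_eq_of_norm_le (k : GL (Fin 2) ℚ_[q])
    (hmax : ∀ i j, ‖k.val i j‖ ≤ ‖k.val 0 0‖) :
    ∃ a ∈ integralUnits q, ∃ n, conjOrder k = conjOrder (a * diagPow q n) := by
  obtain ⟨α, β, γ, δ, hk⟩ : ∃ α β γ δ, k.val = !![α, β; γ, δ] := ⟨_, _, _, _, eta_fin_two _⟩
  have hdet : α * δ - β * γ ≠ 0 := by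
    have := k.isUnit.map (Matrix.detMonoidHom)
    rw [hk] at this
    simpa [det_fin_two] using this.ne_zero
  have hβ : ‖β‖ ≤ ‖α‖ := by simpa [hk] using hmax 0 1
  have hγ : ‖γ‖ ≤ ‖α‖ := by simpa [hk] using hmax 1 0
  have hδ : ‖δ‖ ≤ ‖α‖ := by simpa [hk] using hmax 1 1
  have hα : α ≠ 0 := by
    rintro rfl
    rw [norm_zero, norm_le_zero_iff] at hβ
    simp [hβ] at hdet
  have hα' : 0 < ‖α‖ := norm_pos_iff.2 hα
  have hdiv : ∀ z : ℚ_[q], ‖z‖ ≤ ‖α‖ → ‖z / α‖ ≤ 1 := fun z hz => by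
    rw [norm_div]; exact (div_le_one hα').2 hz
  -- This is the lower right entry left after scaling the pivot to 1 and clearing its row and
  -- column.
  have hw0 : δ / α - γ / α * (β / α) ≠ 0 := by
    have e : δ / α - γ / α * (β / α) = (α * δ - β * γ) / α ^ 2 := by field_simp
    rw [e]
    exact div_ne_zero hdet (pow_ne_zero _ hα)
  have hw : ‖δ / α - γ / α * (β / α)‖ ≤ 1 := by
    rw [sub_eq_add_neg]
    refine (Padic.nonarchimedean _ _).trans (max_le (hdiv _ hδ) ?_)
    rw [norm_neg, norm_mul]
    exact mul_le_one₀ (hdiv _ hγ) (norm_nonneg _) (hdiv _ hβ)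
  obtain ⟨u, n, hu, e⟩ := exists_eq_unit_mul_pow hw0 hw
  have hu0 : u ≠ 0 := norm_ne_zero_iff.1 (by rw [hu]; exact one_ne_zero)
  refine ⟨lowerUnit (γ / α), lowerUnit_mem (hdiv _ hγ), n, ?_⟩
  rw [← conjOrder_mul_integralUnits (lowerUnit (γ / α) * diagPow q n)
    (upperUnit_mem hu0 (hdiv _ hβ) hu)]
  -- `k` is `α` times lower unitriangular times `diag(1, q^n)` times upper triangular; the unit part
  -- `u` goes into the last factor, which does not affect the order.
  refine conjOrder_eq_of_smul (z := α) ?_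
  rw [hk, Units.val_mul, Units.val_mul]
  change _ = α • (!![1, 0; γ / α, 1] * !![1, 0; 0, (q : ℚ_[q]) ^ n] * !![1, β / α; 0, u])
  have e2 : α * (γ / α * (β / α) + (q : ℚ_[q]) ^ n * u) = δ := by
    rw [mul_comm _ u, ← e]
    field_simp
    ring
  simp only [mul_fin_two, smul_of, smul_cons, smul_empty, smul_eq_mul]
  congr 1
  simp [e2, mul_div_cancel₀, hα]

theorem exists_conjOrder_eq_mul_diagPow (k : GL (Fin 2) ℚ_[q]) :
    ∃ a ∈ integralUnits q, ∃ n, conjOrder k = conjOrder (a * diagPow q n) := by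
  -- Swaps bring a largest entry to the top left: a column swap leaves the order unchanged, a row
  -- swap is absorbed into `a`.
  obtain ⟨⟨i, j⟩, hij⟩ := Finite.exists_max fun p : Fin 2 × Fin 2 => ‖k.val p.1 p.2‖
  have row : ∀ k : GL (Fin 2) ℚ_[q], (∀ i j, ‖k.val i j‖ ≤ ‖k.val 0 1‖) →
      ∃ a ∈ integralUnits q, ∃ n, conjOrder k = conjOrder (a * diagPow q n) := by
    intro k hk
    obtain ⟨a, ha, n, h⟩ := exists_conjOrder_eq_of_norm_le (k * swapUnit q) (by
      rw [Units.val_mul, val_swapUnit]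
      intro i j
      fin_cases j <;> simpa [mul_apply, Fin.sum_univ_two] using hk i _)
    exact ⟨a, ha, n, (conjOrder_mul_integralUnits k swapUnit_mem).symm.trans h⟩
  have col : (∃ a ∈ integralUnits q, ∃ n,
        conjOrder (swapUnit q * k) = conjOrder (a * diagPow q n)) →
      ∃ a ∈ integralUnits q, ∃ n, conjOrder k = conjOrder (a * diagPow q n) := by
    rintro ⟨a, ha, n, h⟩
    refine ⟨swapUnit q * a, mul_mem swapUnit_mem ha, n, ?_⟩
    have := conjOrder_mul_congr (swapUnit q) h
    rwa [← mul_assoc, swapUnit_mul_self, one_mul, ← mul_assoc] at this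
  have entry : ∀ i j, (swapUnit q * k).val i j = k.val (1 - i) j := by
    intro i j
    rw [Units.val_mul, val_swapUnit]
    fin_cases i <;> simp [mul_apply, Fin.sum_univ_two]
  fin_cases i <;> fin_cases j
  · exact exists_conjOrder_eq_of_norm_le k fun i j => hij (i, j)
  · exact row k fun i j => hij (i, j)
  · refine col (exists_conjOrder_eq_of_norm_le _ fun i j => ?_)
    rw [entry, entry]
    exact hij (1 - i, j)
  · refine col (row _ fun i j => ?_)
    rw [entry, entry]
    exact hij (1 - i, j)

/-- Any two conjugates of `M_2(ℤ_q)` are simultaneously conjugate to `M_2(ℤ_q)` and its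
conjugate by a diagonal matrix. -/
theorem exists_simultaneous (g h : GL (Fin 2) ℚ_[q]) :
    ∃ g' n, conjOrder g = conjOrder g' ∧ conjOrder h = conjOrder (g' * diagPow q n) := by
  obtain ⟨a, ha, n, e⟩ := exists_conjOrder_eq_mul_diagPow (g⁻¹ * h)
  refine ⟨g * a, n, (conjOrder_mul_integralUnits g ha).symm, ?_⟩
  have := conjOrder_mul_congr g e
  rwa [mul_inv_cancel_left, ← mul_assoc] at this

theorem mem_conjOrder_mul_diagPow {g : GL (Fin 2) ℚ_[q]} {n : ℕ} {a b c d : ℚ_[q]}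
    {x : Matrix (Fin 2) (Fin 2) ℚ_[q]} (hx : g⁻¹.val * x * g.val = !![a, b; c, d]) :
    x ∈ conjOrder (g * diagPow q n) ↔
      ‖a‖ ≤ 1 ∧ ‖b * (q : ℚ_[q]) ^ n‖ ≤ 1 ∧ ‖((q : ℚ_[q]) ^ n)⁻¹ * c‖ ≤ 1 ∧ ‖d‖ ≤ 1 := by
  have e : (g * diagPow q n)⁻¹.val * x * (g * diagPow q n).val =
      !![a, b * (q : ℚ_[q]) ^ n; ((q : ℚ_[q]) ^ n)⁻¹ * c, d] := by
    calc (g * diagPow q n)⁻¹.val * x * (g * diagPow q n).val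
        = (diagPow q n)⁻¹.val * (g⁻¹.val * x * g.val) * (diagPow q n).val := by
          simp only [_root_.mul_inv_rev, Units.val_mul, mul_assoc]
      _ = _ := by
          rw [hx, val_diagPow, val_inv_diagPow]
          have := natCast_prime_ne_zero q
          simp only [mul_fin_two]
          congr 1
          simp
          field_simp
  rw [mem_conjOrder, e, mem_integralMatrices_fin_two]

theorem norm_inv_pow_mul_le_one {n : ℕ} {c : ℚ_[q]} :
    ‖((q : ℚ_[q]) ^ n)⁻¹ * c‖ ≤ 1 ↔ ∃ z : ℤ_[q], c = (q : ℚ_[q]) ^ n * z := by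
  have hq := pow_ne_zero n (natCast_prime_ne_zero q)
  constructor
  · intro h
    exact ⟨⟨_, h⟩, by simp [mul_inv_cancel_left₀ hq]⟩
  · rintro ⟨z, rfl⟩
    rw [inv_mul_cancel_left₀ hq]
    exact z.2

/-- If `q ^ r` times the first of two orders in standard position lies in the second, then
their relative position is at most `r`. -/
theorem le_of_pow_smul_mem {g : GL (Fin 2) ℚ_[q]} {n r : ℕ}
    (h : ∀ x ∈ conjOrder g, (q : ℤ_[q]) ^ r • x ∈ conjOrder (g * diagPow q n)) : n ≤ r := by
  -- Test on the matrix unit E₂₁: conjugation divides its entry by q^n, so q^r / q^n must be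
  -- integral.
  have hx := h _ (conj_mem_conjOrder.2
    (mem_integralMatrices_fin_two (q := q) (a := 0) (b := 0) (c := 1) (d := 0)|>.2 (by simp)))
  have e : g⁻¹.val * ((q : ℤ_[q]) ^ r • (g.val * !![0, 0; 1, 0] * g⁻¹.val)) * g.val =
      !![0, 0; (q : ℚ_[q]) ^ r, 0] := by
    rw [mul_smul_comm, smul_mul_assoc]
    simp only [mul_assoc, Units.inv_mul_cancel_left, Units.inv_mul, mul_one]
    ext i j
    fin_cases i <;> fin_cases j <;> simp [Algebra.smul_def]
  obtain ⟨-, -, h3, -⟩ := (mem_conjOrder_mul_diagPow e).1 hx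
  rw [norm_mul, norm_inv, norm_pow, norm_pow, Padic.norm_p] at h3
  by_contra! hlt
  have hq1 : (1 : ℝ) < q := by exact_mod_cast (Fact.out : q.Prime).one_lt
  have : ((q : ℝ)⁻¹ ^ n)⁻¹ * (q : ℝ)⁻¹ ^ r = (q : ℝ) ^ (n - r) := by
    obtain ⟨m, rfl⟩ := Nat.exists_eq_add_of_lt hlt
    rw [show r + m + 1 - r = m + 1 by omega]
    rw [inv_pow, inv_inv, inv_pow, pow_succ, pow_add, pow_succ]
    field_simp
  rw [this] at h3
  exact absurd h3 (not_le.2 (one_lt_pow₀ hq1 (by omega)))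

/-- An inclusion is the case r = 0 of `le_of_pow_smul_mem`, so the relative position is 0. -/
theorem conjOrder_eq_of_le {g h : GL (Fin 2) ℚ_[q]} (hle : conjOrder g ≤ conjOrder h) :
    conjOrder g = conjOrder h := by
  obtain ⟨g', n, e1, e2⟩ := exists_simultaneous g h
  rw [e1, e2] at hle ⊢
  have hn : n ≤ 0 := le_of_pow_smul_mem (g := g') fun x hx => by
    rw [pow_zero, one_smul]
    exact hle hx
  obtain rfl : n = 0 := by omega
  rw [diagPow_zero, mul_one]

theorem maximal_conjOrder (g : GL (Fin 2) ℚ_[q]) : Maximal (IsLocalOrder q) (conjOrder g) := by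
  refine ⟨isLocalOrder_conjOrder g, fun O hO hle => ?_⟩
  obtain ⟨h, hh⟩ := exists_le_conjOrder hO
  rw [conjOrder_eq_of_le (hle.trans hh)]
  exact hh

/-- The maximal order `g M_2(ℤ_q) g⁻¹`, as a vertex of the tree. -/
noncomputable def vertex (g : GL (Fin 2) ℚ_[q]) : MaximalOrder q :=
  ⟨conjOrder g, maximal_conjOrder g⟩

theorem exists_eq_vertex (O : MaximalOrder q) : ∃ g, O = vertex g := by
  obtain ⟨g, hg⟩ := exists_le_conjOrder O.2.1
  exact ⟨g, Subtype.ext (le_antisymm hg (O.2.2 (isLocalOrder_conjOrder g) hg))⟩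

/-! ### Edges and distances. -/

/-- A `q`-adic number of norm at most `1`, as a `q`-adic integer. -/
def toPadicInt (x : ℚ_[q]) (hx : ‖x‖ ≤ 1) : ℤ_[q] := ⟨x, hx⟩

theorem coe_toPadicInt (x : ℚ_[q]) (hx : ‖x‖ ≤ 1) : (toPadicInt x hx : ℚ_[q]) = x := rfl

theorem eq_toPadicInt_iff {z : ℤ_[q]} {x : ℚ_[q]} {hx : ‖x‖ ≤ 1} :
    toPadicInt x hx = z ↔ x = z := Subtype.ext_iff

/-- The lower left entry modulo `q`, on the order `g M_2(ℤ_q) g⁻¹`. -/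
noncomputable def lowerLeftMod (g : GL (Fin 2) ℚ_[q]) :
    (Subalgebra.toSubmodule (conjOrder g)).toAddSubgroup →+ ZMod q where
  toFun x := PadicInt.toZMod
    (toPadicInt ((g⁻¹.val * x.1 * g.val) 1 0) (mem_integralMatrices.1 (mem_conjOrder.1 x.2) 1 0))
  map_zero' := by
    rw [← map_zero (PadicInt.toZMod (p := q))]
    congr 1
    rw [eq_toPadicInt_iff]
    simp
  map_add' x y := by
    rw [← map_add]
    congr 1
    rw [eq_toPadicInt_iff]
    simp [mul_add, add_mul, coe_toPadicInt]

theorem lowerLeftMod_apply (g : GL (Fin 2) ℚ_[q])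
    (x : (Subalgebra.toSubmodule (conjOrder g)).toAddSubgroup) :
    lowerLeftMod g x = PadicInt.toZMod (toPadicInt ((g⁻¹.val * x.1 * g.val) 1 0)
      (mem_integralMatrices.1 (mem_conjOrder.1 x.2) 1 0)) := rfl

/-- On `conjOrder g`, divisibility of the lower left entry by q is the only condition that is not
automatic. -/
theorem lowerLeftMod_eq_zero_iff {g : GL (Fin 2) ℚ_[q]}
    (x : (Subalgebra.toSubmodule (conjOrder g)).toAddSubgroup) :
    lowerLeftMod g x = 0 ↔ x.1 ∈ conjOrder (g * diagPow q 1) := by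
  have hx := mem_integralMatrices.1 (mem_conjOrder.1 (show x.1 ∈ conjOrder g from x.2))
  have hb : ‖(g⁻¹.val * x.1 * g.val) 0 1 * (q : ℚ_[q]) ^ 1‖ ≤ 1 := by
    rw [norm_mul, pow_one]
    exact mul_le_one₀ (hx 0 1) (norm_nonneg _) Padic.norm_p_lt_one.le
  rw [mem_conjOrder_mul_diagPow (eta_fin_two (g⁻¹.val * x.1 * g.val)), norm_inv_pow_mul_le_one,
    lowerLeftMod_apply, ← RingHom.mem_ker, PadicInt.ker_toZMod, PadicInt.maximalIdeal_eq_span_p,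
    Ideal.mem_span_singleton]
  simp only [hx 0 0, hb, hx 1 1, true_and, and_true]
  refine exists_congr fun z => ?_
  rw [eq_toPadicInt_iff]
  simp

theorem lowerLeftMod_surjective (g : GL (Fin 2) ℚ_[q]) :
    Function.Surjective (lowerLeftMod g) := by
  intro c
  have hc : ‖((c.val : ℤ_[q]) : ℚ_[q])‖ ≤ 1 := (c.val : ℤ_[q]).2
  refine ⟨⟨g.val * !![0, 0; ((c.val : ℤ_[q]) : ℚ_[q]), 0] * g⁻¹.val, conj_mem_conjOrder.2
    (mem_integralMatrices_fin_two.2 (by simpa using hc))⟩, ?_⟩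
  have e : g⁻¹.val * (g.val * !![0, 0; ((c.val : ℤ_[q]) : ℚ_[q]), 0] * g⁻¹.val) * g.val =
      !![0, 0; ((c.val : ℤ_[q]) : ℚ_[q]), 0] := by
    simp only [mul_assoc, Units.inv_mul_cancel_left, Units.inv_mul, mul_one]
  rw [lowerLeftMod_apply, eq_toPadicInt_iff.2 (congrFun (congrFun e 1) 0 :
    _ = ((c.val : ℤ_[q]) : ℚ_[q])), map_natCast, ZMod.natCast_zmod_val]

theorem interIndex_mul_diagPow_one (g : GL (Fin 2) ℚ_[q]) :
    interIndex (conjOrder g) (conjOrder (g * diagPow q 1)) = q := by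
  have e : (Subalgebra.toSubmodule
      (conjOrder g ⊓ conjOrder (g * diagPow q 1))).toAddSubgroup.addSubgroupOf
      (Subalgebra.toSubmodule (conjOrder g)).toAddSubgroup = (lowerLeftMod g).ker := by
    ext x
    rw [AddSubgroup.mem_addSubgroupOf, AddMonoidHom.mem_ker, lowerLeftMod_eq_zero_iff]
    exact ⟨fun h => h.2, fun h => ⟨x.2, h⟩⟩
  rw [interIndex, AddSubgroup.relIndex, e, AddSubgroup.index_ker,
    AddMonoidHom.range_eq_top.2 (lowerLeftMod_surjective g)]
  simp

theorem adj_vertex_mul_diagPow_one (g : GL (Fin 2) ℚ_[q]) :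
    (bruhatTitsTree q).Adj (vertex g) (vertex (g * diagPow q 1)) := by
  refine ⟨interIndex_mul_diagPow_one g, ?_⟩
  have e1 : conjOrder (g * diagPow q 1 * swapUnit q) = conjOrder (g * diagPow q 1) :=
    conjOrder_mul_integralUnits _ swapUnit_mem
  -- With D = `diag(1, q)` and s the swap, D s D = q s. Thus the reverse index is an instance of the
  -- one already computed.
  have e2 : conjOrder (g * diagPow q 1 * swapUnit q * diagPow q 1) = conjOrder g := by
    rw [← conjOrder_mul_integralUnits g swapUnit_mem]
    refine conjOrder_eq_of_smul (z := (q : ℚ_[q])) ?_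
    simp only [Units.val_mul, mul_assoc]
    rw [← mul_smul_comm]
    congr 1
    simp [val_diagPow, val_swapUnit, smul_of]
  have := interIndex_mul_diagPow_one (g * diagPow q 1 * swapUnit q)
  rwa [e1, e2] at this

theorem edist_vertex_mul_diagPow_le (g : GL (Fin 2) ℚ_[q]) (n : ℕ) :
    (bruhatTitsTree q).edist (vertex g) (vertex (g * diagPow q n)) ≤ n := by
  induction n with
  | zero => simp [diagPow_zero]
  | succ n ih =>
    have h := SimpleGraph.edist_eq_one_iff_adj.2 (adj_vertex_mul_diagPow_one (g * diagPow q n))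
    rw [diagPow_succ, ← mul_assoc]
    push_cast
    exact (SimpleGraph.edist_triangle (v := vertex (g * diagPow q n))).trans
      (add_le_add ih h.le)

/-- The quotient of `O` by the intersection has order q, hence is killed by q. -/
theorem smul_mem_of_adj {O O' : MaximalOrder q} (h : (bruhatTitsTree q).Adj O O')
    {x : Matrix (Fin 2) (Fin 2) ℚ_[q]} (hx : x ∈ O.1) : (q : ℤ_[q]) • x ∈ O'.1 := by
  have hi : interIndex O.1 O'.1 = q := h.1
  have := AddSubgroup.nsmul_index_mem
    ((Subalgebra.toSubmodule (O.1 ⊓ O'.1)).toAddSubgroup.addSubgroupOf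
      (Subalgebra.toSubmodule O.1).toAddSubgroup) ⟨x, hx⟩
  rw [← AddSubgroup.relIndex, ← interIndex, hi, AddSubgroup.mem_addSubgroupOf] at this
  rw [Nat.cast_smul_eq_nsmul]
  exact this.2

theorem pow_smul_mem_of_walk {O O' : MaximalOrder q} (w : (bruhatTitsTree q).Walk O O')
    {x : Matrix (Fin 2) (Fin 2) ℚ_[q]} (hx : x ∈ O.1) : (q : ℤ_[q]) ^ w.length • x ∈ O'.1 := by
  induction w generalizing x with
  | nil => simpa using hx
  | cons h p ih =>
    rw [SimpleGraph.Walk.length_cons, pow_succ, mul_smul]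
    exact ih (smul_mem_of_adj h hx)

/-- The `r`-neighborhood of `O` consists of the maximal orders containing `q ^ r O`. -/
theorem mem_neighborhood_iff {r : ℕ} {O O' : MaximalOrder q} :
    O' ∈ neighborhood r O ↔ ∀ x ∈ O.1, (q : ℤ_[q]) ^ r • x ∈ O'.1 := by
  constructor
  · intro h x hx
    have h : (bruhatTitsTree q).edist O O' ≤ r := by rw [SimpleGraph.edist_comm]; exact h
    obtain ⟨w, hw⟩ := (SimpleGraph.reachable_of_edist_ne_top
      (ne_top_of_le_ne_top (ENat.natCast_ne_top r) h)).exists_walk_length_eq_edist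
    rw [← hw, Nat.cast_le] at h
    -- The walk may be shorter than `r`; the surplus power of q is a ℤ_q-scalar.
    obtain ⟨m, rfl⟩ := Nat.exists_eq_add_of_le h
    rw [pow_add, mul_comm, mul_smul]
    exact O'.1.smul_mem (pow_smul_mem_of_walk w hx) _
  · intro h
    obtain ⟨g, rfl⟩ := exists_eq_vertex O
    obtain ⟨g', rfl⟩ := exists_eq_vertex O'
    obtain ⟨k, n, e1, e2⟩ := exists_simultaneous g g'
    have hO : vertex g = vertex k := Subtype.ext e1
    have hO' : vertex g' = vertex (k * diagPow q n) := Subtype.ext e2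
    rw [hO, hO'] at h ⊢
    rw [neighborhood, Set.mem_ofPred_eq, SimpleGraph.edist_comm]
    exact (edist_vertex_mul_diagPow_le k n).trans (Nat.cast_le.2 (le_of_pow_smul_mem h))

/-! ### The intersection over a neighborhood. -/

theorem mem_neighborhoodInter {r : ℕ} {O : MaximalOrder q}
    {x : Matrix (Fin 2) (Fin 2) ℚ_[q]} :
    x ∈ neighborhoodInter r O ↔ ∀ O' ∈ neighborhood r O, x ∈ O'.1 := by
  simp [neighborhoodInter, Algebra.mem_iInf]

theorem exists_eq_add_of_mem_neighborhoodInter {r : ℕ} {O : MaximalOrder q}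
    {x : Matrix (Fin 2) (Fin 2) ℚ_[q]} (hx : x ∈ neighborhoodInter r O) :
    ∃ a : ℤ_[q], ∃ y ∈ O.1,
      x = algebraMap ℤ_[q] (Matrix (Fin 2) (Fin 2) ℚ_[q]) a + (q : ℤ_[q]) ^ r • y := by
  rw [mem_neighborhoodInter] at hx
  obtain ⟨g, rfl⟩ := exists_eq_vertex O
  -- Replacing `g` by `g * k` fixes the center but changes the direction of the path of length at
  -- most `r`.
  have key : ∀ k ∈ integralUnits q, x ∈ conjOrder (g * k * diagPow q r) := by
    intro k hk
    refine hx (vertex _) ?_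
    have e : vertex g = vertex (g * k) := Subtype.ext (conjOrder_mul_integralUnits g hk).symm
    rw [e, neighborhood, Set.mem_ofPred_eq, SimpleGraph.edist_comm]
    exact edist_vertex_mul_diagPow_le _ r
  obtain ⟨a, b, c, d, hX⟩ : ∃ a b c d, g⁻¹.val * x * g.val = !![a, b; c, d] :=
    ⟨_, _, _, _, eta_fin_two _⟩
  have conj : ∀ k : GL (Fin 2) ℚ_[q], (g * k)⁻¹.val * x * (g * k).val =
      k⁻¹.val * !![a, b; c, d] * k.val := by
    intro k
    rw [← hX]
    simp only [_root_.mul_inv_rev, Units.val_mul, mul_assoc]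
  -- The directions 1, swap and lower unipotent make `c`, `b` and `c + d - (a + b)` divisible by
  -- q^r, in that order.
  have h1 := key 1 (one_mem _)
  rw [mul_one, mem_conjOrder_mul_diagPow hX] at h1
  obtain ⟨-, -, hc, hd⟩ := h1
  have e2 : (g * swapUnit q)⁻¹.val * x * (g * swapUnit q).val = !![d, c; b, a] := by
    rw [conj, val_swapUnit, val_inv_swapUnit]
    simp
  have h2 := key _ swapUnit_mem
  rw [mem_conjOrder_mul_diagPow e2] at h2
  obtain ⟨-, -, hb, -⟩ := h2
  have e3 : (g * lowerUnit 1)⁻¹.val * x * (g * lowerUnit 1).val =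
      !![a + b, b; c + d - (a + b), d - b] := by
    rw [conj]
    change !![1, 0; -1, 1] * _ * !![1, 0; 1, 1] = _
    simp only [mul_fin_two]
    congr 1
    simp
    ring_nf
    simp
  have h3 := key _ (lowerUnit_mem (c := 1) (by simp))
  rw [mem_conjOrder_mul_diagPow e3] at h3
  obtain ⟨-, -, hcd, -⟩ := h3
  rw [norm_inv_pow_mul_le_one] at hb hc hcd
  obtain ⟨β, hβ⟩ := hb
  obtain ⟨γ, hγ⟩ := hc
  obtain ⟨δ, hδ⟩ := hcd
  obtain ⟨d, rfl⟩ : ∃ d' : ℤ_[q], (d' : ℚ_[q]) = d := ⟨⟨d, hd⟩, rfl⟩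
  -- Subtracting the scalar `d` clears the lower right entry and leaves a - d = q^r (γ - δ - β) at
  -- the top left.
  refine ⟨d, g.val * !![((γ - δ - β : ℤ_[q]) : ℚ_[q]), β; γ, 0] * g⁻¹.val,
    conj_mem_conjOrder.2 (mem_integralMatrices_fin_two.2
      ⟨PadicInt.norm_le_one _, PadicInt.norm_le_one _, PadicInt.norm_le_one _, by simp⟩), ?_⟩
  have e : !![a, b; c, (d : ℚ_[q])] = algebraMap ℤ_[q] (Matrix (Fin 2) (Fin 2) ℚ_[q]) d +
      (q : ℤ_[q]) ^ r • !![((γ - δ - β : ℤ_[q]) : ℚ_[q]), β; γ, 0] := by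
    have ha : a = d + (q : ℚ_[q]) ^ r * (γ - δ - β) := by
      rw [mul_sub, mul_sub, ← hβ, ← hγ, ← hδ]
      ring
    ext i j
    rw [Matrix.add_apply, Matrix.smul_apply, algebraMap_matrix_apply]
    fin_cases i <;> fin_cases j <;> simp [Algebra.smul_def, hβ, hγ, ha]
  rw [← conj_inv_conj g x, hX, e, mul_add, add_mul, mul_smul_comm, smul_mul_assoc,
    ← Algebra.commutes, mul_assoc _ g.val, Units.mul_inv, mul_one]

end MaximalOrder

theorem proposition4p1 (q : ℕ) [Fact q.Prime] (r : ℕ) (Λ : MaximalOrder q) :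
    (MaximalOrder.neighborhoodInter r Λ : Set (Matrix (Fin 2) (Fin 2) ℚ_[q])) =
        {x | ∃ a : ℤ_[q], ∃ y ∈ Λ.1,
          x = algebraMap ℤ_[q] (Matrix (Fin 2) (Fin 2) ℚ_[q]) a + (q : ℤ_[q]) ^ r • y} ∧
      {Λ' : MaximalOrder q | MaximalOrder.neighborhoodInter r Λ ≤ Λ'.1} =
        MaximalOrder.neighborhood r Λ := by
  have hle : ∀ y ∈ Λ.1, (q : ℤ_[q]) ^ r • y ∈ MaximalOrder.neighborhoodInter r Λ :=
    fun y hy => MaximalOrder.mem_neighborhoodInter.2 fun O' hO' =>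
      MaximalOrder.mem_neighborhood_iff.1 hO' y hy
  constructor
  · ext x
    refine ⟨MaximalOrder.exists_eq_add_of_mem_neighborhoodInter, ?_⟩
    rintro ⟨a, y, hy, rfl⟩
    exact add_mem (Subalgebra.algebraMap_mem _ a) (hle y hy)
  · ext O'
    -- Containing just the part q^r Λ of the intersection already puts `O'` in the neighborhood.
    refine ⟨fun h => MaximalOrder.mem_neighborhood_iff.2 fun y hy => h (hle y hy), fun h x hx => ?_⟩
    exact MaximalOrder.mem_neighborhoodInter.1 hx O' h
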